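/- Let $1\le m$, let $A\in\mathbb R^{m\times n}$ have rank $m$, let $b\in\mathbb R^m$, $c\in\mathbb R^n$, $\sigma,\zeta,\delta\in[0,1]$, and let $x,s\in\mathbb R^n$ have positive entries and $y\in\mathbb R^m$. Put $X=\operatorname{diag}(x)$, $S=\operatorname{diag}(s)$, $D=X^{1/2}S^{-1/2}$, $\mu=x^{\mathsf T}s/n$, $r_p=Ax-b$, $r_d=A^{\mathsf T}y+s-c$, and $$p=-r_p-\sigma\mu AS^{-1}\mathbf 1_n+Ax-AD^2r_d .$$ Let $W$ be a random $n\times w$ sketching matrix with parameters $r=m$, $\zeta$ and $\delta$: for every fixed real matrix $Z$ with $n$ columns, $$\bigl\|ZWW^{\mathsf T}Z^{\mathsf T}-ZZ^{\mathsf T}\bigr\|_2\le\frac{\zeta}{4}\Bigl(\|Z\|_2^2+\frac{\|Z\|_F^2}{m}\Bigr)\quad\text{with probability at least }1-\delta .$$ Let $U_Q\in\mathbb R^{m\times m}$ be an orthogonal matrix of left singular vectors of $ADW$ and $\Sigma_Q^{1/2}$ the diagonal matrix of its $m$ singular values, so that $Q=ADWW^{\mathsf T}DA^{\mathsf T}=U_Q\Sigma_QU_Q^{\mathsf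 T}$, and put $Q^{-1/2}=U_Q\Sigma_Q^{-1/2}U_Q^{\mathsf T}$ (zero singular values, if any, are sent to zero). For $t\ge 0$ let $\tilde z^{t}$ be the iterate after $t$ steps of the standard conjugate gradient method, started at $\tilde z^{0}=0$, for $$Q^{-1/2}AD^2A^{\mathsf T}Q^{-1/2}z=Q^{-1/2}p ,$$ let $\tilde f^{(t)}=Q^{-1/2}AD^2A^{\mathsf T}Q^{-1/2}\tilde z^{t}-Q^{-1/2}p$ be its residual, let $\widehat{\Delta y}=Q^{-1/2}\tilde z^{t}$, and let $$v=(XS)^{1/2}\,W\,(ADW)^{\dagger}\bigl(AD^2A^{\mathsf T}\widehat{\Delta y}-p\bigr)$$ be the perturbation vector, where $\dagger$ denotes the Moore–Penrose inverse. Then, with probability at least $1-\delta$, $$\|v\|_2\le\sqrt{3n\mu}\;\|\tilde f^{(t)}\|_2 .$$ -/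

import Mathlib

open MeasureTheory
open scoped Matrix

noncomputable section

namespace SketchIPM

/-- The Euclidean norm of a real vector. -/
def vecNorm {k : ℕ} (u : Fin k → ℝ) : ℝ := ‖WithLp.toLp 2 u‖

open scoped Matrix.Norms.L2Operator in
/-- The spectral norm of a real matrix. -/
def specNorm {k l : ℕ} (M : Matrix (Fin k) (Fin l) ℝ) : ℝ := ‖M‖

/-- The square of the Frobenius norm of a real matrix. -/
def frobSq {k l : ℕ} (M : Matrix (Fin k) (Fin l) ℝ) : ℝ := ∑ i, ∑ j, M i j ^ 2

/-- The random `n × w` matrix `W` is a sketching matrix with parameters `r`, `ζ` and failure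
probability `δ`: its entries are random variables and, for every fixed matrix `Z` with `n` columns,
`‖Z W Wᵀ Zᵀ - Z Zᵀ‖₂ ≤ (ζ / 4) (‖Z‖₂² + ‖Z‖_F² / r)` with probability at least `1 - δ`. -/
def IsSketchingMatrix {Ω : Type*} [MeasurableSpace Ω] (P : Measure Ω) {n w : ℕ}
    (W : Ω → Matrix (Fin n) (Fin w) ℝ) (r : ℕ) (ζ δ : ℝ) : Prop :=
  (∀ i j, Measurable fun ω => W ω i j) ∧
  ∀ (k : ℕ) (Z : Matrix (Fin k) (Fin n) ℝ),
    ENNReal.ofReal (1 - δ) ≤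
      P {ω | specNorm (Z * W ω * (W ω)ᵀ * Zᵀ - Z * Zᵀ)
              ≤ ζ / 4 * (specNorm Z ^ 2 + frobSq Z / r)}

section Spectral

variable {m w : ℕ}

theorem isHermitian_gram (B : Matrix (Fin m) (Fin w) ℝ) : (B * Bᵀ).IsHermitian :=
  Matrix.isHermitian_mul_conjTranspose_self B

/-- An orthogonal matrix of left singular vectors of `B` (eigenvectors of `B Bᵀ`). -/
def leftSing (B : Matrix (Fin m) (Fin w) ℝ) : Matrix (Fin m) (Fin m) ℝ :=
  ((isHermitian_gram B).eigenvectorUnitary : Matrix (Fin m) (Fin m) ℝ)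

/-- The singular values of `B`, in the order of the columns of `leftSing B`: the square roots of
the eigenvalues of `B Bᵀ`. -/
def singVal (B : Matrix (Fin m) (Fin w) ℝ) (i : Fin m) : ℝ :=
  √((isHermitian_gram B).eigenvalues i)

/-- `Q^{-1/2} = U Σ^{-1/2} Uᵀ` for `Q = B Bᵀ`, where `U` and `Σ^{1/2}` hold the left singular
vectors and the singular values of `B`. A zero singular value is sent to zero, so that
for singular `Q` this is the Moore-Penrose inverse of `Q^{1/2}`. -/
def invSqrtGram (B : Matrix (Fin m) (Fin w) ℝ) : Matrix (Fin m) (Fin m) ℝ :=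
  leftSing B * Matrix.diagonal (fun i => (singVal B i)⁻¹) * (leftSing B)ᵀ

/-- The Moore-Penrose inverse `B† = Bᵀ (B Bᵀ)†`; see `pinv_penrose`. -/
def pinv (B : Matrix (Fin m) (Fin w) ℝ) : Matrix (Fin w) (Fin m) ℝ :=
  Bᵀ * (leftSing B * Matrix.diagonal (fun i => (singVal B i ^ 2)⁻¹) * (leftSing B)ᵀ)

theorem leftSing_transpose_mul (B : Matrix (Fin m) (Fin w) ℝ) :
    (leftSing B)ᵀ * leftSing B = 1 :=
  Unitary.coe_star_mul_self (isHermitian_gram B).eigenvectorUnitary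

theorem singVal_sq (B : Matrix (Fin m) (Fin w) ℝ) (i : Fin m) :
    singVal B i ^ 2 = (isHermitian_gram B).eigenvalues i :=
  Real.sq_sqrt ((Matrix.posSemidef_self_mul_conjTranspose B).eigenvalues_nonneg i)

theorem gram_eq (B : Matrix (Fin m) (Fin w) ℝ) :
    B * Bᵀ = leftSing B * Matrix.diagonal (fun i => singVal B i ^ 2) * (leftSing B)ᵀ := by
  have h := (isHermitian_gram B).spectral_theorem
  simp only [singVal_sq]
  simpa [Unitary.conjStarAlgAut_apply, leftSing, Matrix.star_eq_conjTranspose,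
    Function.comp_def] using h

/-- The four Penrose equations, which characterise the Moore-Penrose inverse. -/
theorem pinv_penrose (B : Matrix (Fin m) (Fin w) ℝ) :
    B * pinv B * B = B ∧ pinv B * B * pinv B = pinv B ∧
      (B * pinv B)ᵀ = B * pinv B ∧ (pinv B * B)ᵀ = pinv B * B := by
  set U := leftSing B with hU
  have hUU : Uᵀ * U = 1 := leftSing_transpose_mul B
  set G := U * Matrix.diagonal (fun i => (singVal B i ^ 2)⁻¹) * Uᵀ with hG
  have hGt : Gᵀ = G := by
    simp [hG, Matrix.transpose_mul, Matrix.mul_assoc]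
  have hp : pinv B = Bᵀ * G := rfl
  have hg : B * Bᵀ = U * Matrix.diagonal (fun i => singVal B i ^ 2) * Uᵀ := gram_eq B
  have key : ∀ a b : Fin m → ℝ, (U * Matrix.diagonal a * Uᵀ) * (U * Matrix.diagonal b * Uᵀ)
      = U * Matrix.diagonal (fun i => a i * b i) * Uᵀ := by
    intro a b
    calc _ = U * Matrix.diagonal a * (Uᵀ * U) * Matrix.diagonal b * Uᵀ := by
          simp only [Matrix.mul_assoc]
      _ = _ := by rw [hUU, Matrix.mul_one, Matrix.mul_assoc U, Matrix.diagonal_mul_diagonal]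
  have h3 : (B * Bᵀ) * G * (B * Bᵀ) = B * Bᵀ := by
    rw [hg, hG, key, key]
    congr 3
    funext i
    by_cases h : singVal B i ^ 2 = 0 <;> simp [h]
  have h4 : G * (B * Bᵀ) * G = G := by
    rw [hg, hG, key, key]
    congr 3
    funext i
    by_cases h : singVal B i ^ 2 = 0 <;> simp [h]
  have h5 : (B * Bᵀ) * G = G * (B * Bᵀ) := by
    rw [hg, hG, key, key]
    simp only [mul_comm]
  refine ⟨?_, ?_, ?_, ?_⟩
  · have hz : (B * Bᵀ * G * B - B) * (B * Bᵀ * G * B - B)ᵀ = 0 := by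
      have e : (B * Bᵀ * G * B - B)ᵀ = Bᵀ * (G * (B * Bᵀ)) - Bᵀ := by
        simp [Matrix.transpose_mul, hGt, Matrix.mul_assoc]
      rw [e, Matrix.sub_mul, Matrix.mul_sub, Matrix.mul_sub]
      have e1 : B * Bᵀ * G * B * (Bᵀ * (G * (B * Bᵀ))) = B * Bᵀ := by
        calc _ = (B * Bᵀ * G * (B * Bᵀ)) * G * (B * Bᵀ) := by simp only [Matrix.mul_assoc]
          _ = _ := by rw [h3, h3]
      have e2 : B * Bᵀ * G * B * Bᵀ = B * Bᵀ := by
        calc _ = B * Bᵀ * G * (B * Bᵀ) := by simp only [Matrix.mul_assoc]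
          _ = _ := h3
      have e3 : B * (Bᵀ * (G * (B * Bᵀ))) = B * Bᵀ := by
        calc _ = B * Bᵀ * G * (B * Bᵀ) := by simp only [Matrix.mul_assoc]
          _ = _ := h3
      rw [e1, e2, e3]; simp
    have := Matrix.self_mul_conjTranspose_eq_zero.mp hz
    rw [hp, ← Matrix.mul_assoc]
    exact sub_eq_zero.mp this
  · rw [hp]
    calc _ = Bᵀ * (G * (B * Bᵀ) * G) := by simp only [Matrix.mul_assoc]
      _ = _ := by rw [h4]
  · rw [hp, ← Matrix.mul_assoc, Matrix.transpose_mul, hGt, h5]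
    simp [Matrix.transpose_mul]
  · rw [hp]
    simp [Matrix.transpose_mul, hGt, Matrix.mul_assoc]

end Spectral

section ConjugateGradient

/-- The state of the conjugate gradient method: iterate, residual `q - M z`, search direction. -/
structure CGState (m : ℕ) where
  iter : Fin m → ℝ
  res : Fin m → ℝ
  dir : Fin m → ℝ

/-- One step of the standard conjugate gradient method for `M z = q`. (Once the residual vanishes,
the iterate no longer changes, as `0 / 0 = 0`.) -/
def cgStep {m : ℕ} (M : Matrix (Fin m) (Fin m) ℝ) (S : CGState m) : CGState m :=
  let a : ℝ := (S.res ⬝ᵥ S.res) / (S.dir ⬝ᵥ M *ᵥ S.dir)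
  let res' : Fin m → ℝ := S.res - a • (M *ᵥ S.dir)
  { iter := S.iter + a • S.dir
    res := res'
    dir := res' + ((res' ⬝ᵥ res') / (S.res ⬝ᵥ S.res)) • S.dir }

/-- The `t`-th iterate of the conjugate gradient method for `M z = q`, started at `z = 0`. -/
def cgIter {m : ℕ} (M : Matrix (Fin m) (Fin m) ℝ) (q : Fin m → ℝ) (t : ℕ) : Fin m → ℝ :=
  ((cgStep M)^[t] ⟨0, q, q⟩).iter

end ConjugateGradient

section InteriorPoint

variable {m n w : ℕ}

/-- The duality measure `μ = xᵀ s / n`. -/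
def dualityMeasure (x s : Fin n → ℝ) : ℝ := (x ⬝ᵥ s) / n

/-- The matrix `D = X^{1/2} S^{-1/2}`. -/
def scaling (x s : Fin n → ℝ) : Matrix (Fin n) (Fin n) ℝ :=
  Matrix.diagonal fun i => √(x i) * (√(s i))⁻¹

/-- The matrix `(X S)^{1/2}`. -/
def sqrtXS (x s : Fin n → ℝ) : Matrix (Fin n) (Fin n) ℝ :=
  Matrix.diagonal fun i => √(x i * s i)

/-- The primal residual `r_p = A x - b`. -/
def primalRes (A : Matrix (Fin m) (Fin n) ℝ) (b : Fin m → ℝ) (x : Fin n → ℝ) : Fin m → ℝ :=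
  A *ᵥ x - b

/-- The dual residual `r_d = Aᵀ y + s - c`. -/
def dualRes (A : Matrix (Fin m) (Fin n) ℝ) (c : Fin n → ℝ) (y : Fin m → ℝ) (s : Fin n → ℝ) :
    Fin n → ℝ :=
  Aᵀ *ᵥ y + s - c

/-- The matrix `A D² Aᵀ` of the normal equations. -/
def normalMatrix (A : Matrix (Fin m) (Fin n) ℝ) (x s : Fin n → ℝ) : Matrix (Fin m) (Fin m) ℝ :=
  A * scaling x s ^ 2 * Aᵀ

/-- The right-hand side of the normal equations,
`p = - r_p - σ μ A S⁻¹ 1 + A x - A D² r_d`. -/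
def normalRhs (A : Matrix (Fin m) (Fin n) ℝ) (b : Fin m → ℝ) (c : Fin n → ℝ) (σ : ℝ)
    (x : Fin n → ℝ) (y : Fin m → ℝ) (s : Fin n → ℝ) : Fin m → ℝ :=
  -primalRes A b x - (σ * dualityMeasure x s) • (A *ᵥ fun i => (s i)⁻¹) + A *ᵥ x
    - (A * scaling x s ^ 2) *ᵥ dualRes A c y s

/-- The inverse square root `Q^{-1/2}` of the preconditioner `Q = (A D W) (A D W)ᵀ`. -/
def precond (A : Matrix (Fin m) (Fin n) ℝ) (x s : Fin n → ℝ) (W : Matrix (Fin n) (Fin w) ℝ) :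
    Matrix (Fin m) (Fin m) ℝ :=
  invSqrtGram (A * scaling x s * W)

/-- The approximate solution `z̃ᵗ` after `t` steps of conjugate gradients, from `z̃⁰ = 0`, on
`Q^{-1/2} A D² Aᵀ Q^{-1/2} z = Q^{-1/2} p`. -/
def cgSolution (A : Matrix (Fin m) (Fin n) ℝ) (x s : Fin n → ℝ) (W : Matrix (Fin n) (Fin w) ℝ)
    (p : Fin m → ℝ) (t : ℕ) : Fin m → ℝ :=
  cgIter (precond A x s W * normalMatrix A x s * precond A x s W) (precond A x s W *ᵥ p) t

/-- The residual `f̃ᵗ = Q^{-1/2} A D² Aᵀ Q^{-1/2} z̃ᵗ - Q^{-1/2} p`. -/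
def cgResidual (A : Matrix (Fin m) (Fin n) ℝ) (x s : Fin n → ℝ) (W : Matrix (Fin n) (Fin w) ℝ)
    (p : Fin m → ℝ) (t : ℕ) : Fin m → ℝ :=
  (precond A x s W * normalMatrix A x s * precond A x s W) *ᵥ cgSolution A x s W p t
    - precond A x s W *ᵥ p

/-- The approximate search direction `Δŷ = Q^{-1/2} z̃ᵗ`. -/
def approxDy (A : Matrix (Fin m) (Fin n) ℝ) (x s : Fin n → ℝ) (W : Matrix (Fin n) (Fin w) ℝ)
    (p : Fin m → ℝ) (t : ℕ) : Fin m → ℝ :=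
  precond A x s W *ᵥ cgSolution A x s W p t

/-- The perturbation vector `v = (X S)^{1/2} W (A D W)† (A D² Aᵀ Δŷ - p)`. -/
def perturbation (A : Matrix (Fin m) (Fin n) ℝ) (x s : Fin n → ℝ)
    (W : Matrix (Fin n) (Fin w) ℝ) (p : Fin m → ℝ) (t : ℕ) : Fin n → ℝ :=
  (sqrtXS x s * W * pinv (A * scaling x s * W)) *ᵥ
    (normalMatrix A x s *ᵥ approxDy A x s W p t - p)

end InteriorPoint

end SketchIPM

end

namespace SketchIPM

open scoped Matrix.Norms.L2Operator

/-! Write `B = A D W` and `Q = B Bᵀ`. Since `B† = Bᵀ Q^{-1/2} Q^{-1/2}` and one factor `Q^{-1/2}`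
turns `A D² Aᵀ Δŷ - p` into the residual `f̃`, the perturbation factors as `v = ((X S)^{1/2} W) (Bᵀ
Q^{-1/2}) f̃` (`perturbation_eq`). The middle factor is a contraction, even for singular `Q`, so
`‖v‖ ≤ ‖(X S)^{1/2} W‖ ‖f̃‖` for every outcome of `W`. Randomness enters only through `‖(X S)^{1/2}
W‖`. The sketching property for the single fixed matrix `Z = (X S)^{1/2}` compares `Z W Wᵀ Zᵀ` with
`Z Zᵀ`. As `‖Z‖²` and `‖Z‖_F²` are both at most `xᵀ s = n μ`, this gives `‖Z W‖² ≤ (3/2) n μ`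
(`specNorm_sqrtXS_mul_sq_le`). -/

theorem vecNorm_mulVec_le {k l : ℕ} (M : Matrix (Fin k) (Fin l) ℝ) (u : Fin l → ℝ) :
    vecNorm (M *ᵥ u) ≤ specNorm M * vecNorm u :=
  Matrix.l2_opNorm_mulVec M (WithLp.toLp 2 u)

theorem specNorm_sq_eq_transpose_mul_self {k l : ℕ} (M : Matrix (Fin k) (Fin l) ℝ) :
    specNorm M ^ 2 = specNorm (Mᵀ * M) := by
  rw [sq]
  exact (Matrix.l2_opNorm_conjTranspose_mul_self M).symm

theorem specNorm_transpose {k l : ℕ} (M : Matrix (Fin k) (Fin l) ℝ) :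
    specNorm Mᵀ = specNorm M :=
  Matrix.l2_opNorm_conjTranspose M

theorem specNorm_sq_eq_self_mul_transpose {k l : ℕ} (M : Matrix (Fin k) (Fin l) ℝ) :
    specNorm M ^ 2 = specNorm (M * Mᵀ) := by
  rw [← specNorm_transpose, specNorm_sq_eq_transpose_mul_self, Matrix.transpose_transpose]

theorem specNorm_nonneg {k l : ℕ} (M : Matrix (Fin k) (Fin l) ℝ) : 0 ≤ specNorm M :=
  norm_nonneg M

theorem specNorm_mul_le {k l r : ℕ} (M : Matrix (Fin k) (Fin l) ℝ) (N : Matrix (Fin l) (Fin r) ℝ) :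
    specNorm (M * N) ≤ specNorm M * specNorm N :=
  Matrix.l2_opNorm_mul M N

theorem specNorm_diagonal_le {k : ℕ} {d : Fin k → ℝ} {C : ℝ} (hC : 0 ≤ C) (h : ∀ i, |d i| ≤ C) :
    specNorm (Matrix.diagonal d) ≤ C := by
  rw [specNorm, Matrix.l2_opNorm_diagonal]
  exact (pi_norm_le_iff_of_nonneg hC).2 h

/-! ### The inverse square root of a Gram matrix. -/

section Spectral

variable {m w : ℕ}

theorem specNorm_leftSing_le_one (B : Matrix (Fin m) (Fin w) ℝ) : specNorm (leftSing B) ≤ 1 := by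
  have h := specNorm_sq_eq_transpose_mul_self (leftSing B)
  rw [leftSing_transpose_mul, ← Matrix.diagonal_one] at h
  have h1 : specNorm (Matrix.diagonal fun _ : Fin m => (1 : ℝ)) ≤ 1 :=
    specNorm_diagonal_le zero_le_one fun _ => by simp
  exact (sq_le_one_iff₀ (specNorm_nonneg _)).1 (h.trans_le h1)

/-- Functions of `B Bᵀ` share an eigenbasis, so identities between them reduce to scalar identities
in the singular values. -/
theorem leftSing_conj_mul (B : Matrix (Fin m) (Fin w) ℝ) (d e : Fin m → ℝ) :
    leftSing B * Matrix.diagonal d * (leftSing B)ᵀ *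
        (leftSing B * Matrix.diagonal e * (leftSing B)ᵀ) =
      leftSing B * Matrix.diagonal (fun i => d i * e i) * (leftSing B)ᵀ := by
  calc _ = leftSing B * Matrix.diagonal d * ((leftSing B)ᵀ * leftSing B) * Matrix.diagonal e *
        (leftSing B)ᵀ := by simp only [Matrix.mul_assoc]
    _ = _ := by
      rw [leftSing_transpose_mul, Matrix.mul_one, Matrix.mul_assoc (leftSing B),
        Matrix.diagonal_mul_diagonal]

theorem specNorm_leftSing_conj_le (B : Matrix (Fin m) (Fin w) ℝ) {d : Fin m → ℝ}
    (hd : ∀ i, |d i| ≤ 1) :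
    specNorm (leftSing B * Matrix.diagonal d * (leftSing B)ᵀ) ≤ 1 := by
  have hU := specNorm_leftSing_le_one B
  refine (specNorm_mul_le _ _).trans (mul_le_one₀ ?_ (specNorm_nonneg _) ?_)
  · exact (specNorm_mul_le _ _).trans
      (mul_le_one₀ hU (specNorm_nonneg _) (specNorm_diagonal_le zero_le_one hd))
  · rwa [specNorm_transpose]

theorem invSqrtGram_transpose (B : Matrix (Fin m) (Fin w) ℝ) :
    (invSqrtGram B)ᵀ = invSqrtGram B := by
  simp [invSqrtGram, Matrix.transpose_mul, Matrix.mul_assoc]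

theorem pinv_eq_transpose_mul_invSqrtGram (B : Matrix (Fin m) (Fin w) ℝ) :
    pinv B = Bᵀ * invSqrtGram B * invSqrtGram B := by
  rw [Matrix.mul_assoc, invSqrtGram, leftSing_conj_mul, pinv]
  simp only [sq, mul_inv]

/-- The matrix `Bᵀ (B Bᵀ)^{-1/2}` is a contraction (in fact a partial isometry). -/
theorem specNorm_transpose_mul_invSqrtGram_le_one (B : Matrix (Fin m) (Fin w) ℝ) :
    specNorm (Bᵀ * invSqrtGram B) ≤ 1 := by
  have h : (Bᵀ * invSqrtGram B)ᵀ * (Bᵀ * invSqrtGram B) =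
      invSqrtGram B * (B * Bᵀ) * invSqrtGram B := by
    simp only [Matrix.transpose_mul, Matrix.transpose_transpose, invSqrtGram_transpose,
      Matrix.mul_assoc]
  rw [← sq_le_one_iff₀ (specNorm_nonneg _), specNorm_sq_eq_transpose_mul_self, h, gram_eq,
    invSqrtGram, leftSing_conj_mul, leftSing_conj_mul]
  refine specNorm_leftSing_conj_le B fun i => ?_
  -- The diagonal entry `σ⁻¹ σ² σ⁻¹` is 0 on the kernel of `B Bᵀ`, as `0⁻¹ = 0`, and 1 elsewhere.
  by_cases h0 : singVal B i = 0
  · simp [h0]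
  · have : (singVal B i)⁻¹ * singVal B i ^ 2 * (singVal B i)⁻¹ = 1 := by field_simp
    simp [this]

end Spectral

/-! ### The perturbation vector and the sketch of `(X S)^{1/2}`. -/

section InteriorPoint

variable {m n w : ℕ}

theorem natCast_mul_dualityMeasure (x s : Fin n → ℝ) : n * dualityMeasure x s = x ⬝ᵥ s := by
  rcases eq_or_ne n 0 with rfl | hn
  · simp
  · rw [dualityMeasure, mul_div_cancel₀ _ (Nat.cast_ne_zero.2 hn)]

theorem frobSq_sqrtXS {x s : Fin n → ℝ} (hx : ∀ i, 0 < x i) (hs : ∀ i, 0 < s i) :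
    frobSq (sqrtXS x s) = x ⬝ᵥ s := by
  refine Finset.sum_congr rfl fun i _ => ?_
  rw [Finset.sum_eq_single i (fun j _ hj => by simp [sqrtXS, Matrix.diagonal_apply_ne _ hj.symm])
    (by simp)]
  simp [sqrtXS, Real.sq_sqrt (mul_pos (hx i) (hs i)).le]

/-- The largest of the positive products `x i * s i` is at most their sum. -/
theorem specNorm_sqrtXS_sq_le {x s : Fin n → ℝ} (hx : ∀ i, 0 < x i) (hs : ∀ i, 0 < s i) :
    specNorm (sqrtXS x s) ^ 2 ≤ x ⬝ᵥ s := by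
  have hpos : ∀ i, 0 ≤ x i * s i := fun i => (mul_pos (hx i) (hs i)).le
  have h0 : 0 ≤ x ⬝ᵥ s := Finset.sum_nonneg fun i _ => hpos i
  refine (Real.le_sqrt (specNorm_nonneg _) h0).1 ?_
  refine specNorm_diagonal_le (Real.sqrt_nonneg _) fun i => ?_
  rw [abs_of_nonneg (Real.sqrt_nonneg _)]
  exact Real.sqrt_le_sqrt
    (Finset.single_le_sum (f := fun i => x i * s i) (fun j _ => hpos j) (Finset.mem_univ i))

/-- Of the two factors `Q^{-1/2}` in `B†`, the right one is absorbed into the residual; the left one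
stays with `Bᵀ` to form a contraction. -/
theorem perturbation_eq (A : Matrix (Fin m) (Fin n) ℝ) (x s : Fin n → ℝ)
    (W : Matrix (Fin n) (Fin w) ℝ) (p : Fin m → ℝ) (t : ℕ) :
    perturbation A x s W p t = (sqrtXS x s * W) *ᵥ
      (((A * scaling x s * W)ᵀ * precond A x s W) *ᵥ cgResidual A x s W p t) := by
  have h : cgResidual A x s W p t =
      precond A x s W *ᵥ (normalMatrix A x s *ᵥ approxDy A x s W p t - p) := by
    simp only [cgResidual, approxDy, Matrix.mulVec_sub, Matrix.mulVec_mulVec, Matrix.mul_assoc]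
  rw [perturbation, h, pinv_eq_transpose_mul_invSqrtGram]
  simp only [precond, Matrix.mulVec_mulVec, Matrix.mul_assoc]

theorem vecNorm_perturbation_le (A : Matrix (Fin m) (Fin n) ℝ) (x s : Fin n → ℝ)
    (W : Matrix (Fin n) (Fin w) ℝ) (p : Fin m → ℝ) (t : ℕ) :
    vecNorm (perturbation A x s W p t) ≤
      specNorm (sqrtXS x s * W) * vecNorm (cgResidual A x s W p t) := by
  rw [perturbation_eq]
  refine (vecNorm_mulVec_le _ _).trans
    (mul_le_mul_of_nonneg_left ?_ (specNorm_nonneg _))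
  exact (vecNorm_mulVec_le _ _).trans
    (mul_le_of_le_one_left (norm_nonneg _) (specNorm_transpose_mul_invSqrtGram_le_one _))

/-- The spectral norm of `(X S)^{1/2} W` where the sketch succeeds on `(X S)^{1/2}`. -/
theorem specNorm_sqrtXS_mul_sq_le {x s : Fin n → ℝ} (hx : ∀ i, 0 < x i) (hs : ∀ i, 0 < s i)
    {r : ℕ} (hr : 1 ≤ r) {ζ : ℝ} (hζ : ζ ∈ Set.Icc (0 : ℝ) 1) (W : Matrix (Fin n) (Fin w) ℝ)
    (hW : specNorm (sqrtXS x s * W * Wᵀ * (sqrtXS x s)ᵀ - sqrtXS x s * (sqrtXS x s)ᵀ) ≤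
      ζ / 4 * (specNorm (sqrtXS x s) ^ 2 + frobSq (sqrtXS x s) / r)) :
    specNorm (sqrtXS x s * W) ^ 2 ≤ 3 / 2 * (x ⬝ᵥ s) := by
  set Z := sqrtXS x s with hZ
  have hZ2 : specNorm Z ^ 2 ≤ x ⬝ᵥ s := specNorm_sqrtXS_sq_le hx hs
  have h0 : 0 ≤ x ⬝ᵥ s := (sq_nonneg _).trans hZ2
  have hF : frobSq Z / r ≤ x ⬝ᵥ s := by
    rw [hZ, frobSq_sqrtXS hx hs]
    exact div_le_self h0 (by exact_mod_cast hr)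
  have htri : specNorm (Z * W * (Z * W)ᵀ) ≤
      specNorm (Z * W * Wᵀ * Zᵀ - Z * Zᵀ) + specNorm (Z * Zᵀ) := by
    have e : Z * W * (Z * W)ᵀ = (Z * W * Wᵀ * Zᵀ - Z * Zᵀ) + Z * Zᵀ := by
      simp [Matrix.transpose_mul, Matrix.mul_assoc]
    rw [e]
    exact norm_add_le _ _
  rw [← specNorm_sq_eq_self_mul_transpose, ← specNorm_sq_eq_self_mul_transpose] at htri
  -- With `ζ ≤ 1` the sketching error is at most `xᵀ s / 2`; adding `‖Z Zᵀ‖ ≤ xᵀ s` gives the factor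
  -- `3 / 2`.
  have hE : ζ / 4 * (specNorm Z ^ 2 + frobSq Z / r) ≤ 1 / 4 * (x ⬝ᵥ s + x ⬝ᵥ s) :=
    mul_le_mul (by linarith [hζ.2]) (add_le_add hZ2 hF)
      (add_nonneg (sq_nonneg _) (div_nonneg (by rw [hZ, frobSq_sqrtXS hx hs]; exact h0)
        (Nat.cast_nonneg r))) (by norm_num)
  linarith

end InteriorPoint

end SketchIPM

theorem mainTheorem5 {Ω : Type*} [MeasurableSpace Ω] (P : Measure Ω) [IsProbabilityMeasure P]
    {m n w : ℕ} (hm : 1 ≤ m)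
    (A : Matrix (Fin m) (Fin n) ℝ) (hA : A.rank = m) (b : Fin m → ℝ) (c : Fin n → ℝ)
    (x : Fin n → ℝ) (y : Fin m → ℝ) (s : Fin n → ℝ) (hx : ∀ i, 0 < x i) (hs : ∀ i, 0 < s i)
    (σ : ℝ) (hσ : σ ∈ Set.Icc (0 : ℝ) 1)
    (ζ δ : ℝ) (hζ : ζ ∈ Set.Icc (0 : ℝ) 1) (hδ : δ ∈ Set.Icc (0 : ℝ) 1)
    (W : Ω → Matrix (Fin n) (Fin w) ℝ) (hW : SketchIPM.IsSketchingMatrix P W m ζ δ) (t : ℕ) :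
    ENNReal.ofReal (1 - δ) ≤
      P {ω | SketchIPM.vecNorm
                (SketchIPM.perturbation A x s (W ω) (SketchIPM.normalRhs A b c σ x y s) t)
              ≤ √(3 * n * SketchIPM.dualityMeasure x s) *
                SketchIPM.vecNorm
                  (SketchIPM.cgResidual A x s (W ω) (SketchIPM.normalRhs A b c σ x y s) t)} := by
  -- The bound holds on the whole event where the sketch succeeds on `(X S)^{1/2}`, so the failure
  -- probability `δ` is spent once.
  refine (hW.2 n (SketchIPM.sqrtXS x s)).trans (measure_mono fun ω hω => ?_)
  have hsq := SketchIPM.specNorm_sqrtXS_mul_sq_le hx hs hm hζ (W ω) hω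
  have h0 : 0 ≤ x ⬝ᵥ s := Finset.sum_nonneg fun i _ => (mul_pos (hx i) (hs i)).le
  refine (SketchIPM.vecNorm_perturbation_le A x s (W ω) _ t).trans
    (mul_le_mul_of_nonneg_right (Real.le_sqrt_of_sq_le ?_) (norm_nonneg _))
  rw [mul_assoc, SketchIPM.natCast_mul_dualityMeasure]
  -- The factor `3 / 2` is relaxed to `3`, using `0 ≤ xᵀ s`.
  linarith
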